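/- Let $\kappa$ be an (uncountable, strongly) inaccessible cardinal. For $f,g\in{}^\kappa\kappa$ write $f\leq^* g$ if there is $\beta<\kappa$ with $f(\alpha)\leq g(\alpha)$ for all $\alpha>\beta$, and $f=^\infty g$ if for every $\beta<\kappa$ there is $\alpha>\beta$ with $f(\alpha)=g(\alpha)$; write $f\mathrel{\cancel{=^\infty}}g$ for the negation of $f=^\infty g$. Let $\mathfrak b_\kappa(\leq^*)$ be the least size of a set $F\subseteq{}^\kappa\kappa$ such that no $g\in{}^\kappa\kappa$ satisfies $f\leq^* g$ for all $f\in F$, and let $\mathfrak d_\kappa(\leq^*)$ be the least size of a set $D\subseteq{}^\kappa\kappa$ such that every $f\in{}^\kappa\kappa$ satisfies $f\leq^* g$ for some $g\in D$. For a function $b\in{}^\kappa\kappa$ let $\prod b=\{f\in{}^\kappa\kappa : f(\alpha)<b(\alpha)\text{ for all }\alpha<\kappa\}$. Let $\mathfrak d^b_\kappa(\mathrel{\cancel{=^\infty}})$ be the least size of a set $D\subseteq\prod b$ such that for every $f\in\prod b$ there is $g\in D$ with $f\mathrel{\cancel{=^\infty}}g$, and let $\mathfrak b^b_\kappa(\mathrel{\cancel{=^\infty}})$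 be the least size of a set $F\subseteq\prod b$ such that for every $g\in\prod b$ there is $f\in F$ with $f=^\infty g$. Put $$\mathfrak{inf}_\kappa(\mathrel{\cancel{=^\infty}})=\inf_b\,\mathfrak d^b_\kappa(\mathrel{\cancel{=^\infty}}),\qquad \mathfrak{sup}_\kappa(\mathrel{\cancel{=^\infty}})=\sup_b\,\mathfrak b^b_\kappa(\mathrel{\cancel{=^\infty}}),$$ where $b$ ranges over the (weakly) increasing functions $b\in{}^\kappa\kappa$ all of whose values are infinite cardinals. Give ${}^\kappa\kappa$ the ${<}\kappa$-box topology, whose basic open sets are $[s]=\{f\in{}^\kappa\kappa : s\subseteq f\}$ for $s\in{}^\gamma\kappa$, $\gamma<\kappa$. A set $A\subseteq{}^\kappa\kappa$ is nowhere dense if every basic open set $[s]$ includes a basic open set $[t]\subseteq[s]$ with $[t]\cap A=\emptyset$; let $\mathcal M_\kappa$ be the family of $\kappa$-meagre sets, i.e. of unions of $\kappa$ many nowhere dense sets. Let $\mathrm{add}(\mathcal M_\kappa)$ be the least size of a family $\mathcal A\subseteq\mathcal M_\kappa$ with $\bigcup\mathcal A\notin\mathcal M_\kappa$, and $\mathrm{cof}(\mathcal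 M_\kappa)$ the least size of a family $\mathcal F\subseteq\mathcal M_\kappa$ such that every $A\in\mathcal M_\kappa$ is included in some $B\in\mathcal F$. Then $$\mathrm{add}(\mathcal M_\kappa)=\min\{\mathfrak b_\kappa(\leq^*),\ \mathfrak{inf}_\kappa(\mathrel{\cancel{=^\infty}})\}\qquad\text{and}\qquad \mathrm{cof}(\mathcal M_\kappa)=\max\{\mathfrak d_\kappa(\leq^*),\ \mathfrak{sup}_\kappa(\mathrel{\cancel{=^\infty}})\}.$$ -/

import Mathlib

universe u

open Cardinal

namespace GenBaire

/-! ### Relational systems -/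

/-- A relational system `⟨X, Y, R⟩` with `R ⊆ X × Y`. -/
structure RelSystem where
  X : Type u
  Y : Type u
  R : X → Y → Prop

/-- The norm: the least size of a set `W ⊆ Y` such that every `x ∈ X` is related to a member
of `W`. -/
noncomputable def RelSystem.norm (S : RelSystem.{u}) : Cardinal.{u} :=
  sInf {c | ∃ W : Set S.Y, #W = c ∧ ∀ x : S.X, ∃ y ∈ W, S.R x y}

/-- The dual relational system `⟨Y, X, {(y, x) | (x, y) ∉ R}⟩`. -/
def RelSystem.dual (S : RelSystem.{u}) : RelSystem.{u} where
  X := S.Y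
  Y := S.X
  R := fun y x => ¬ S.R x y

/-! ### The generalised Baire space -/

/-- The cardinal `κ` seen as a well-ordered type: the elements are (in order-preserving
bijection with) the ordinals below the initial ordinal of `κ`. -/
abbrev Idx (κ : Cardinal.{u}) : Type u := κ.ord.ToType

/-- The generalised Baire space: all functions from `κ` to `κ`. -/
abbrev Space (κ : Cardinal.{u}) : Type u := Idx κ → Idx κ

variable {κ : Cardinal.{u}}

/-- `P α` holds for almost all `α ∈ κ`. -/
def AlmostAll (P : Idx κ → Prop) : Prop := ∃ β, ∀ α, β < α → P α

/-- `P α` holds for cofinally many `α ∈ κ`. -/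
def CofinallyMany (P : Idx κ → Prop) : Prop := ∀ β, ∃ α, β < α ∧ P α

/-- `f ≤* g`. -/
def LeStar (f g : Space κ) : Prop := AlmostAll fun α => f α ≤ g α

/-- `f =^∞ g`. -/
def EqInf (f g : Space κ) : Prop := CofinallyMany fun α => f α = g α

/-- The product `∏ b`: all `f` with `f α ∈ b α`, that is `f α < b α`, for all `α ∈ κ`. -/
def prodBelow (b : Space κ) : Set (Space κ) := {f | ∀ α, f α < b α}

/-- Admissible bounds: (weakly) increasing functions `b : κ → κ` all of whose values are infinite
cardinals. -/
def IsBound (b : Space κ) : Prop :=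
  Monotone b ∧ ∀ α, ∃ c : Cardinal.{u}, ℵ₀ ≤ c ∧ ((b α).toOrd : Ordinal.{u}) = c.ord

/-- The relational system `⟨S, S, ≤*⟩` on a set `S` of functions from `κ` to `κ`. -/
def domSystem (S : Set (Space κ)) : RelSystem.{u} where
  X := S
  Y := S
  R := fun f g => LeStar f.1 g.1

/-- The relational system `⟨S, S, ≠^∞⟩` on a set `S` of functions from `κ` to `κ`, where `≠^∞`
denotes the negation of `=^∞`. -/
def evtDiffSystem (S : Set (Space κ)) : RelSystem.{u} where
  X := S
  Y := S
  R := fun f g => ¬ EqInf f.1 g.1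

/-- The dominating number `𝔡_κ(≤*)`. -/
noncomputable def domNumber (κ : Cardinal.{u}) : Cardinal.{u} :=
  (domSystem (Set.univ : Set (Space κ))).norm

/-- The unbounding number `𝔟_κ(≤*)`. -/
noncomputable def unbNumber (κ : Cardinal.{u}) : Cardinal.{u} :=
  (domSystem (Set.univ : Set (Space κ))).dual.norm

/-- The eventual difference number `𝔡_κ^b(≠^∞)` of the bounded space `∏ b`. -/
noncomputable def evtDiffNumber (b : Space κ) : Cardinal.{u} :=
  (evtDiffSystem (prodBelow b)).norm

/-- The cofinal equality number `𝔟_κ^b(≠^∞)` of the bounded space `∏ b`. -/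
noncomputable def cofEqNumber (b : Space κ) : Cardinal.{u} :=
  (evtDiffSystem (prodBelow b)).dual.norm

/-- `𝔦𝔫𝔣_κ(≠^∞)`: the infimum of the eventual difference numbers `𝔡_κ^b(≠^∞)`. -/
noncomputable def infEvtDiff (κ : Cardinal.{u}) : Cardinal.{u} :=
  sInf {c | ∃ b : Space κ, IsBound b ∧ c = evtDiffNumber b}

/-- `𝔰𝔲𝔭_κ(≠^∞)`: the supremum of the cofinal equality numbers `𝔟_κ^b(≠^∞)`. -/
noncomputable def supCofEq (κ : Cardinal.{u}) : Cardinal.{u} :=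
  sSup {c | ∃ b : Space κ, IsBound b ∧ c = cofEqNumber b}

/-! ### The ideal of `κ`-meagre sets -/

/-- The basic open set `[s]` of all `f : κ → κ` extending `s : γ → κ`, where `γ ∈ κ`. -/
def basicOpen {γ : Idx κ} (s : Set.Iio γ → Idx κ) : Set (Space κ) :=
  {f | ∀ α : Set.Iio γ, f α = s α}

/-- Nowhere dense sets for the `<κ`-box topology: every basic open set includes a basic open set
disjoint from `A`. -/
def IsNwd (A : Set (Space κ)) : Prop :=
  ∀ (γ : Idx κ) (s : Set.Iio γ → Idx κ), ∃ (δ : Idx κ) (t : Set.Iio δ → Idx κ),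
    basicOpen t ⊆ basicOpen s ∧ basicOpen t ∩ A = ∅

/-- The family `ℳ_κ` of `κ`-meagre sets: unions of `κ` many nowhere dense sets. -/
def meagreIdeal (κ : Cardinal.{u}) : Set (Set (Space κ)) :=
  {A | ∃ N : Idx κ → Set (Space κ), (∀ α, IsNwd (N α)) ∧ A = ⋃ α, N α}

/-- `add(I)`: the least size of a subfamily of `I` whose union is not in `I`. -/
noncomputable def addIdeal {Z : Type u} (I : Set (Set Z)) : Cardinal.{u} :=
  sInf {c | ∃ F : Set (Set Z), F ⊆ I ∧ ⋃₀ F ∉ I ∧ #F = c}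

/-- `cof(I)`: the least size of a subfamily of `I` that is cofinal in `I` under inclusion. -/
noncomputable def cofIdeal {Z : Type u} (I : Set (Set Z)) : Cardinal.{u} :=
  sInf {c | ∃ F : Set (Set Z), F ⊆ I ∧ (∀ A ∈ I, ∃ B ∈ F, A ⊆ B) ∧ #F = c}

end GenBaire

/-!
The proof follows the classical one for `ω`, with inaccessibility of `κ` in place of the finiteness
of `n ^ n`.

*Baire category.* By regularity, functions can be built by fusion in `κ` steps (`exists_fusion`).
Hence the whole space is not meagre, and unions of fewer than `κ` nowhere dense sets are nowhere
dense. As `κ` is a strong limit, there are fewer than `κ` functions from `α` to `α`, so a single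
continuation takes all of them out of a given nowhere dense set
(`IsNwd.exists_uniform_extension`). This attaches a growth rate `g : κ → κ` to every meagre set
(`exists_isEscapeRate`).

*`add ≤ 𝔟` and `𝔡 ≤ cof`.* For monotone `f` the set `{x | x ≤* f}` is meagre, and it is included in a
meagre set with growth rate `g` only if `f ≤* g` (`exists_le_notMem`).

*`add ≤ 𝔡^b` and `𝔟^b ≤ cof`.* For `g ∈ ∏ b` the set of `x` whose truncation to `∏ b` is eventually
different from `g` is meagre (`setOf_not_eqInf_mem_meagreIdeal`). If the functions `g` form a witness
for `𝔡^b`, these sets cover the space; points missed by the members of a cofinal family of meagre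
sets give a witness for `𝔟^b`.

*The converse inequalities.* All meagre sets whose growth rate is dominated by one function `h` can
be coded by elements of one product `∏ b`: on each of `κ` many disjoint intervals determined by `h`,
record the continuation that escapes from the corresponding nowhere dense set. If `f ∈ ∏ b` agrees
cofinally often with such a code, and `h'` dominates the function that finds the next place of
agreement, then the meagre set is included in a meagre set `M f h'` that depends only on `h`, `f` and
`h'` (`exists_meagre_cover`). For fewer than `min {𝔟, 𝔦𝔫𝔣}` many meagre sets the functions `h`, `f` and
`h'` can be chosen to serve all of them at once; for the cofinality, one lets `h` and `h'` range over a
dominating family and `f` over a witness for `𝔟^b`.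
-/

namespace GenBaire

open Set

variable {κ : Cardinal.{u}}

section Recursion

/-! ### The order type `κ` and bounded functions on it -/

section Idx

theorem mk_Iio_idx_lt (α : Idx κ) : #(Iio α) < κ := by
  simpa using mk_Iio_lt α

variable [hκ : Fact κ.IsInaccessible]

instance : Nonempty (Idx κ) := nonempty_ord_toType hκ.out.ne_zero

noncomputable instance : OrderBot (Idx κ) := WellFoundedLT.toOrderBot _

/-- Regularity of `κ`: fewer than `κ` many elements of `κ` have a strict upper bound. -/
theorem exists_forall_lt {ι : Type u} (hι : #ι < κ) (f : ι → Idx κ) : ∃ β, ∀ i, f i < β := by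
  by_contra! h
  have hc : IsCofinal (range f) := fun β => by
    obtain ⟨i, hi⟩ := h β
    exact ⟨f i, mem_range_self i, hi⟩
  have h1 := Order.cof_le hc
  rw [Ordinal.cof_toType, hκ.out.isRegular.cof_ord] at h1
  exact (h1.trans mk_range_le).not_gt hι

instance : NoMaxOrder (Idx κ) where
  exists_gt α := by
    obtain ⟨β, hβ⟩ := exists_forall_lt (ι := PUnit.{u + 1})
      (by simpa using hκ.out.nat_lt 1) (fun _ => α)
    exact ⟨β, hβ ⟨⟩⟩

theorem mk_Iic_idx_lt (α : Idx κ) : #(Iic α) < κ := by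
  obtain ⟨β, hβ⟩ := exists_gt α
  exact (mk_le_mk_of_subset fun x hx => lt_of_le_of_lt hx hβ).trans_lt
    (mk_Iio_idx_lt β)

theorem exists_forall_Iio_lt (γ : Idx κ) (f : Idx κ → Idx κ) : ∃ β, ∀ α < γ, f α < β := by
  obtain ⟨β, hβ⟩ := exists_forall_lt (mk_Iio_idx_lt γ) (fun i => f i)
  exact ⟨β, fun α hα => hβ ⟨α, hα⟩⟩

/-- Every function on `κ` is dominated everywhere by a monotone one. -/
theorem exists_monotone_ge (f : Space κ) : ∃ g : Space κ, Monotone g ∧ ∀ α, f α ≤ g α := by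
  have h : ∀ α, ∃ β, ∀ i : Iic α, f i.1 < β := fun α =>
    exists_forall_lt (mk_Iic_idx_lt α) (fun i => f i.1)
  refine ⟨fun α => wellFounded_lt.min _ (h α), fun α α' hα => ?_, fun α => ?_⟩
  · exact not_lt.1 (wellFounded_lt.not_lt_min {β | ∀ i : Iic α, f i.1 < β} fun i =>
      wellFounded_lt.min_mem _ (h α') ⟨i.1, le_trans i.2 hα⟩)
  · exact (wellFounded_lt.min_mem _ (h α) ⟨α, mem_Iic.2 le_rfl⟩).le

/-- The functions that map `γ` to `γ` and vanish from `γ` on: a normalised copy of `^γ γ`. -/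
def boundedFun (γ : Idx κ) : Set (Space κ) :=
  {p | (∀ β < γ, p β < γ) ∧ ∀ β, γ ≤ β → p β = ⊥}

theorem boundedFun_mono {γ γ' : Idx κ} (h : γ ≤ γ') : boundedFun γ ⊆ boundedFun γ' := by
  rintro p ⟨h1, h2⟩
  refine ⟨fun β hβ => ?_, fun β hβ => h2 β (h.trans hβ)⟩
  by_cases hb : β < γ
  · exact (h1 β hb).trans_le h
  · rw [h2 β (not_lt.1 hb)]
    exact bot_le.trans_lt hβ

theorem bot_mem_boundedFun (γ : Idx κ) : (fun _ => ⊥ : Space κ) ∈ boundedFun γ :=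
  ⟨fun _ hβ => bot_le.trans_lt hβ, fun _ _ => rfl⟩

/-- Since `κ` is a strong limit, there are fewer than `κ` functions from `γ` to `γ`. -/
theorem mk_boundedFun_lt (γ : Idx κ) : #(boundedFun γ) < κ := by
  let φ : boundedFun γ → (Iio γ → Iio γ) := fun p i => ⟨p.1 i, p.2.1 i i.2⟩
  have hφ : Function.Injective φ := by
    rintro ⟨p, hp⟩ ⟨q, hq⟩ h
    ext β
    by_cases hb : β < γ
    · exact congrArg Subtype.val (congrFun h ⟨β, hb⟩)
    · change p β = q β
      rw [hp.2 β (not_lt.1 hb), hq.2 β (not_lt.1 hb)]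
  refine (mk_le_of_injective hφ).trans_lt ?_
  have h1 : #(Iio γ → Iio γ) ≤ max ℵ₀ #(Iio γ) ^ max ℵ₀ #(Iio γ) := by
    rw [← power_def]
    exact (power_le_power_right (le_max_right _ _)).trans
      (power_le_power_left (aleph0_pos.trans_le (le_max_left _ _)).ne' (le_max_right _ _))
  refine h1.trans_lt ?_
  rw [power_self_eq (le_max_left _ _)]
  exact hκ.out.isStrongPrelimit
    (max_lt hκ.out.aleph0_lt (mk_Iio_idx_lt γ))

/-- For each monotone `γ` there is an admissible bound `b` such that the elements of
`^(γ ξ) (γ ξ)` can be coded by the elements of `b ξ`. -/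
theorem exists_isBound_coding (γ : Idx κ → Idx κ) (hγ : Monotone γ) :
    ∃ b : Space κ, IsBound b ∧ ∃ e : Idx κ → Idx κ → Space κ,
      (∀ ξ β, e ξ β ∈ boundedFun (γ ξ)) ∧
      ∀ ξ, ∀ p ∈ boundedFun (γ ξ), ∃ β < b ξ, e ξ β = p := by
  let c : Idx κ → Cardinal.{u} := fun ξ => max ℵ₀ #(boundedFun (γ ξ))
  have hc : ∀ ξ, c ξ < κ := fun ξ => max_lt hκ.out.aleph0_lt (mk_boundedFun_lt _)
  let b : Space κ := fun ξ => Ordinal.ToType.mk ⟨(c ξ).ord, ord_lt_ord.2 (hc ξ)⟩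
  have hb : ∀ ξ, #(Iio (b ξ)) = c ξ := by
    intro ξ
    have h : Ordinal.typein (α := Idx κ) (· < ·) (b ξ) = (c ξ).ord :=
      Ordinal.typein_enum (α := Idx κ) (· < ·) _
    rw [← card_ord (c ξ), ← h]
    rfl
  have hinj : ∀ ξ, ∃ φ : boundedFun (γ ξ) → Iio (b ξ), Function.Injective φ := fun ξ => by
    have : #(boundedFun (γ ξ)) ≤ #(Iio (b ξ)) := by
      rw [hb]
      exact le_max_right _ _
    obtain ⟨φ⟩ := this
    exact ⟨φ, φ.injective⟩
  choose φ hφ using hinj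
  have : ∀ ξ, Nonempty (boundedFun (γ ξ)) := fun ξ => ⟨⟨_, bot_mem_boundedFun _⟩⟩
  classical
  refine ⟨b, ⟨fun ξ ξ' h => ?_, fun ξ => ⟨c ξ, le_max_left _ _, ?_⟩⟩,
    fun ξ β => (Function.invFun (fun p => (φ ξ p : Idx κ)) β).1, fun ξ β => Subtype.mem _,
    fun ξ p hp => ⟨φ ξ ⟨p, hp⟩, (φ ξ ⟨p, hp⟩).2, ?_⟩⟩
  · refine Ordinal.ToType.mk.monotone (Subtype.mk_le_mk.2 (ord_le_ord.2 ?_))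
    exact max_le_max le_rfl (mk_le_mk_of_subset (boundedFun_mono (hγ h)))
  · simp [b]
  · exact congrArg Subtype.val
      (Function.leftInverse_invFun (Subtype.val_injective.comp (hφ ξ)) ⟨p, hp⟩)

end Idx

/-! ### Recursion along `κ` -/

/-- Well-founded recursion for a relational step: if a value `b` with `P ξ F b` exists for every `ξ`
and `F`, where `P ξ F` depends only on the values of `F` below `ξ`, then values can be chosen at all
`ξ` simultaneously. -/
theorem exists_forall_rec {ι β : Type*} [LinearOrder ι] [WellFoundedLT ι] [Nonempty β]
    (P : ι → (ι → β) → β → Prop)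
    (hP : ∀ ξ F F' b, (∀ η < ξ, F η = F' η) → P ξ F b → P ξ F' b)
    (h : ∀ ξ F, ∃ b, P ξ F b) : ∃ s : ι → β, ∀ ξ, P ξ s (s ξ) := by
  classical
  choose G hG using h
  let ext : ∀ ξ, (∀ η, η < ξ → β) → ι → β := fun ξ F η =>
    if h : η < ξ then F η h else Classical.arbitrary β
  let s : ι → β := (wellFounded_lt (α := ι)).fix fun ξ F => G ξ (ext ξ F)
  refine ⟨s, fun ξ => ?_⟩
  have h1 : s ξ = G ξ (ext ξ fun η _ => s η) := WellFounded.fix_eq _ _ _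
  rw [h1]
  refine hP ξ _ _ _ (fun η hη => ?_) (hG ξ (ext ξ fun η _ => s η))
  simp [ext, hη]

variable [hκ : Fact κ.IsInaccessible]

/-- Functions on initial segments of `κ` that agree where they overlap have a common extension.
The `i`-th of them is given as the restriction of `x i` to `γ i`. -/
theorem exists_eqOn_of_compatible {ι : Type*} (x : ι → Space κ) (γ : ι → Idx κ)
    (h : ∀ i j β, β < γ i → β < γ j → x i β = x j β) :
    ∃ y : Space κ, ∀ i, EqOn (x i) y (Iio (γ i)) := by
  classical
  refine ⟨fun β => if hb : ∃ i, β < γ i then x hb.choose β else ⊥, fun i β hβ => ?_⟩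
  have hb : ∃ i, β < γ i := ⟨i, hβ⟩
  simp only [hb, dif_pos]
  exact h _ _ _ hβ hb.choose_spec

/-- Fusion: a function on `κ` can be built in `κ` steps, where the `ξ`-th step extends what has
been decided so far, a function on `δ ξ`, to a function on some `γ ξ > δ ξ` so as to force the
property `Q ξ (δ ξ) (γ ξ)`. The intervals `[δ ξ, γ ξ)` of the steps cover `κ`. -/
theorem exists_fusion (Q : Idx κ → Idx κ → Idx κ → Space κ → Prop)
    (hQ : ∀ ξ δ y, ∃ γ > δ, ∃ x : Space κ, EqOn y x (Iio δ) ∧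
      ∀ x', EqOn x x' (Iio γ) → Q ξ δ γ x') :
    ∃ (x : Space κ) (δ γ : Idx κ → Idx κ), (∀ ξ, δ ξ < γ ξ) ∧ (∀ ξ, ∀ η < ξ, γ η ≤ δ ξ) ∧
      (∀ β, ∃ ξ, δ ξ ≤ β ∧ β < γ ξ) ∧ ∀ ξ, Q ξ (δ ξ) (γ ξ) x := by
  -- A step is recorded as a triple `(x, δ, γ)`.
  let Good : Idx κ → (Idx κ → Space κ × Idx κ × Idx κ) → Space κ × Idx κ × Idx κ → Prop :=
    fun ξ F b => b.2.1 < b.2.2 ∧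
      (∀ η < ξ, (F η).2.2 ≤ b.2.1 ∧ EqOn (F η).1 b.1 (Iio (F η).2.2)) ∧
      (∀ β < b.2.1, ∃ η < ξ, β < (F η).2.2) ∧ ∀ x', EqOn b.1 x' (Iio b.2.2) → Q ξ b.2.1 b.2.2 x'
  let Coh : Idx κ → (Idx κ → Space κ × Idx κ × Idx κ) → Prop := fun ξ F =>
    ∀ η < ξ, ∀ η' < η, (F η').2.2 ≤ (F η).2.2 ∧ EqOn (F η').1 (F η).1 (Iio (F η').2.2)
  obtain ⟨s, hs⟩ := exists_forall_rec (fun ξ F b => Coh ξ F → Good ξ F b) (by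
      intro ξ F F' b hF hb hc
      have := hb fun η hη η' hη' => by
        rw [hF η hη, hF η' (hη'.trans hη)]; exact hc η hη η' hη'
      refine ⟨this.1, fun η hη => ?_, fun β hβ => ?_, this.2.2.2⟩
      · rw [← hF η hη]; exact this.2.1 η hη
      · obtain ⟨η, hη, h⟩ := this.2.2.1 β hβ
        exact ⟨η, hη, by rwa [← hF η hη]⟩) (by
      intro ξ F
      by_cases hc : Coh ξ F
      swap
      · exact ⟨Classical.arbitrary _, fun h => absurd h hc⟩
      obtain ⟨y, hy⟩ := exists_eqOn_of_compatible (fun i : Iio ξ => (F i).1)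
        (fun i => (F i).2.2) (by
          intro i j β hi hj
          rcases lt_trichotomy i j with h | h | h
          · exact (hc j j.2 i h).2 hi
          · rw [h]
          · exact ((hc i i.2 j h).2 hj).symm)
      have hex : ∃ δ, ∀ η < ξ, (F η).2.2 ≤ δ := by
        obtain ⟨β, hβ⟩ := exists_forall_Iio_lt ξ (fun η => (F η).2.2)
        exact ⟨β, fun η hη => (hβ η hη).le⟩
      let δ := wellFounded_lt.min {δ | ∀ η < ξ, (F η).2.2 ≤ δ} hex
      have hδ : ∀ η < ξ, (F η).2.2 ≤ δ := wellFounded_lt.min_mem _ hex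
      obtain ⟨γ, hγ, x, hx, hxQ⟩ := hQ ξ δ y
      refine ⟨(x, δ, γ), fun _ => ⟨hγ, fun η hη => ⟨hδ η hη, fun β hβ => ?_⟩, fun β hβ => ?_, hxQ⟩⟩
      · exact (hy ⟨η, hη⟩ hβ).trans (hx (lt_of_lt_of_le hβ (hδ η hη)))
      · by_contra! hcon
        exact wellFounded_lt.not_lt_min (s := {δ | ∀ η < ξ, (F η).2.2 ≤ δ}) hcon hβ)
  have hgood : ∀ ξ, Good ξ s (s ξ) := by
    intro ξ
    induction ξ using WellFoundedLT.induction with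
    | ind ξ ih =>
      refine hs ξ fun η hη η' hη' => ?_
      have := ih η hη
      exact ⟨(this.2.1 η' hη').1.trans this.1.le, (this.2.1 η' hη').2⟩
  obtain ⟨x, hx⟩ := exists_eqOn_of_compatible (fun i => (s i).1) (fun i => (s i).2.2) (by
    intro i j β hi hj
    rcases lt_trichotomy i j with h | h | h
    · exact ((hgood j).2.1 i h).2 hi
    · rw [h]
    · exact (((hgood i).2.1 j h).2 hj).symm)
  have hmono : StrictMono fun ξ => (s ξ).2.2 := fun η ξ h =>
    ((hgood ξ).2.1 η h).1.trans_lt (hgood ξ).1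
  refine ⟨x, fun ξ => (s ξ).2.1, fun ξ => (s ξ).2.2, fun ξ => (hgood ξ).1,
    fun ξ η hη => ((hgood ξ).2.1 η hη).1, fun β => ?_, fun ξ => (hgood ξ).2.2.2 x (hx ξ)⟩
  have hex : ∃ ξ, β < (s ξ).2.2 := by
    obtain ⟨ξ, hξ⟩ := exists_gt β
    exact ⟨ξ, hξ.trans_le (hmono.le_apply)⟩
  refine ⟨wellFounded_lt.min {ξ | β < (s ξ).2.2} hex, ?_, wellFounded_lt.min_mem _ hex⟩
  by_contra! hcon
  obtain ⟨η, hη, h⟩ := (hgood _).2.2.1 β hcon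
  exact wellFounded_lt.not_lt_min (s := {ξ | β < (s ξ).2.2}) h hη

end Recursion

section Meagre

/-! ### Nowhere dense and meagre sets -/

open Classical in
/-- The function that agrees with `x` below `γ` and with `y` from `γ` on. -/
noncomputable def splice (γ : Idx κ) (x y : Space κ) : Space κ :=
  fun β => if β < γ then x β else y β

theorem splice_of_lt {γ β : Idx κ} (x y : Space κ) (h : β < γ) : splice γ x y β = x β :=
  if_pos h

theorem splice_of_le {γ β : Idx κ} (x y : Space κ) (h : γ ≤ β) : splice γ x y β = y β :=
  if_neg h.not_gt

theorem eqOn_splice (γ : Idx κ) (x y : Space κ) : EqOn x (splice γ x y) (Iio γ) :=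
  fun _ hβ => (splice_of_lt x y hβ).symm

theorem splice_congr {γ δ : Idx κ} (x : Space κ) {y y' : Space κ} (h : EqOn y y' (Iio δ)) :
    EqOn (splice γ x y) (splice γ x y') (Iio δ) := by
  intro β hβ
  by_cases hb : β < γ
  · rw [splice_of_lt _ _ hb, splice_of_lt _ _ hb]
  · rw [splice_of_le _ _ (not_lt.1 hb), splice_of_le _ _ (not_lt.1 hb), h hβ]

theorem splice_splice (γ : Idx κ) (x y z : Space κ) :
    splice γ x (splice γ y z) = splice γ x z := by
  funext β
  by_cases hb : β < γ
  · rw [splice_of_lt _ _ hb, splice_of_lt _ _ hb]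
  · rw [splice_of_le _ _ (not_lt.1 hb), splice_of_le _ _ (not_lt.1 hb),
      splice_of_le _ _ (not_lt.1 hb)]

theorem splice_eq_of_eqOn {γ : Idx κ} {x y : Space κ} (h : EqOn x y (Iio γ)) :
    splice γ x y = y := by
  funext β
  by_cases hb : β < γ
  · rw [splice_of_lt _ _ hb, h hb]
  · rw [splice_of_le _ _ (not_lt.1 hb)]

variable [hκ : Fact κ.IsInaccessible]

/-- Nowhere density in terms of total functions: the basic open set of the restriction of `x`
to `γ` is the set of all `y` with `EqOn x y (Iio γ)`. -/
theorem isNwd_iff {A : Set (Space κ)} :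
    IsNwd A ↔ ∀ (x : Space κ) (γ : Idx κ), ∃ (x' : Space κ) (δ : Idx κ), γ < δ ∧
      EqOn x x' (Iio γ) ∧ ∀ y, EqOn x' y (Iio δ) → y ∉ A := by
  classical
  constructor
  · intro h x γ
    obtain ⟨δ, t, hts, htA⟩ := h γ fun i => x i
    let x' : Space κ := fun β => if hb : β < δ then t ⟨β, hb⟩ else ⊥
    have hx' : ∀ i : Iio δ, x' i = t i := fun i => dif_pos i.2
    obtain ⟨ε, hε⟩ := exists_gt (max γ δ)
    refine ⟨x', ε, (le_max_left _ _).trans_lt hε, fun β hβ => ?_, fun y hy hyA => ?_⟩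
    · have : x' ∈ basicOpen t := hx'
      exact (hts this ⟨β, hβ⟩).symm
    · have : y ∈ basicOpen t := fun i => by
        rw [← hx' i]
        exact (hy (lt_trans i.2 ((le_max_right _ _).trans_lt hε))).symm
      exact (htA.subset ⟨this, hyA⟩ : y ∈ (∅ : Set (Space κ)))
  · intro h γ s
    let x : Space κ := fun β => if hb : β < γ then s ⟨β, hb⟩ else ⊥
    have hx : ∀ i : Iio γ, x i = s i := fun i => dif_pos i.2
    obtain ⟨x', δ, hγδ, hxx', hδ⟩ := h x γ
    refine ⟨δ, fun i => x' i, fun y hy i => ?_, ?_⟩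
    · rw [← hx i, hxx' i.2]
      exact hy ⟨i, lt_trans i.2 hγδ⟩
    · rw [← disjoint_iff_inter_eq_empty, Set.disjoint_left]
      exact fun y hy => hδ y fun β hβ => (hy ⟨β, hβ⟩).symm

theorem IsNwd.mono {A B : Set (Space κ)} (hB : IsNwd B) (h : A ⊆ B) : IsNwd A := by
  rw [isNwd_iff] at *
  intro x γ
  obtain ⟨x', δ, h1, h2, h3⟩ := hB x γ
  exact ⟨x', δ, h1, h2, fun y hy hA => h3 y hy (h hA)⟩

theorem IsNwd.preimage_splice {A : Set (Space κ)} (hA : IsNwd A) (γ : Idx κ) (s : Space κ) :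
    IsNwd (splice γ s ⁻¹' A) := by
  rw [isNwd_iff] at *
  intro x ε
  obtain ⟨x', δ, h1, h2, h3⟩ := hA (splice γ s x) (max ε γ)
  refine ⟨splice γ x x', δ, (le_max_left _ _).trans_lt h1, fun β hβ => ?_, fun y hy hyA => ?_⟩
  · by_cases hb : β < γ
    · rw [splice_of_lt _ _ hb]
    · rw [splice_of_le _ _ (not_lt.1 hb), ← h2 (mem_Iio.2 (lt_of_lt_of_le hβ (le_max_left _ _))),
        splice_of_le _ _ (not_lt.1 hb)]
  · refine h3 _ (fun β hβ => ?_) hyA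
    rw [← splice_congr s hy hβ, splice_splice]
    by_cases hb : β < γ
    · rw [splice_of_lt _ _ hb, ← h2 (mem_Iio.2 (lt_of_lt_of_le hb (le_max_right _ _))),
        splice_of_lt _ _ hb]
    · rw [splice_of_le _ _ (not_lt.1 hb)]

/-- A sequence of `κ` many nowhere dense sets can be avoided by a single function, each of the
sets being avoided already on an initial segment. -/
theorem exists_forall_eqOn_notMem {N : Idx κ → Set (Space κ)} (hN : ∀ ξ, IsNwd (N ξ)) :
    ∃ (x : Space κ) (γ : Idx κ → Idx κ), StrictMono γ ∧
      ∀ ξ y, EqOn x y (Iio (γ ξ)) → y ∉ N ξ := by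
  obtain ⟨x, δ, γ, h1, h2, -, h3⟩ := exists_fusion
    (fun ξ _ γ x => ∀ y, EqOn x y (Iio γ) → y ∉ N ξ) (by
      intro ξ δ y
      obtain ⟨x', ε, hε, hx', h⟩ := isNwd_iff.1 (hN ξ) y δ
      exact ⟨ε, hε, x', hx', fun z hz w hw => h w (hz.trans hw)⟩)
  exact ⟨x, γ, fun η ξ h => (h2 ξ η h).trans_lt (h1 ξ), h3⟩

/-- The Baire category theorem for `κ`. -/
theorem univ_notMem_meagreIdeal : (univ : Set (Space κ)) ∉ meagreIdeal κ := by
  rintro ⟨N, hN, h⟩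
  obtain ⟨x, γ, -, hx⟩ := exists_forall_eqOn_notMem hN
  obtain ⟨ξ, hξ⟩ := mem_iUnion.1 (h ▸ mem_univ x)
  exact hx ξ x (eqOn_refl _ _) hξ

theorem isNwd_empty : IsNwd (∅ : Set (Space κ)) :=
  isNwd_iff.2 fun x γ => by
    obtain ⟨δ, h⟩ := exists_gt γ
    exact ⟨x, δ, h, eqOn_refl _ _, fun _ _ h => h⟩

/-- The union of fewer than `κ` nowhere dense sets is nowhere dense. -/
theorem isNwd_iUnion {ι : Type u} (hι : #ι < κ) {N : ι → Set (Space κ)}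
    (hN : ∀ i, IsNwd (N i)) : IsNwd (⋃ i, N i) := by
  classical
  have hle : #ι ≤ #(Idx κ) := by simpa using hι.le
  obtain ⟨e⟩ := hle
  -- Avoid the sets in `κ` steps, `N i` at step `e i`; by regularity, all is done by some step `ξ`.
  obtain ⟨ξ, hξ⟩ := exists_forall_lt hι e
  rw [isNwd_iff]
  intro x ε
  let N' : Idx κ → Set (Space κ) := fun η =>
    if h : ∃ i, e i = η then splice ε x ⁻¹' N h.choose else ∅
  have hN' : ∀ η, IsNwd (N' η) := by
    intro η
    by_cases h : ∃ i, e i = η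
    · simp only [N', dif_pos h]
      exact (hN _).preimage_splice _ _
    · simp only [N', dif_neg h]
      exact isNwd_empty
  obtain ⟨z, γ, hγ, hz⟩ := exists_forall_eqOn_notMem hN'
  obtain ⟨δ, hδ⟩ := exists_gt (max ε (γ ξ))
  refine ⟨splice ε x z, δ, (le_max_left _ _).trans_lt hδ, eqOn_splice _ _ _, fun y hy hyN => ?_⟩
  obtain ⟨i, hi⟩ := mem_iUnion.1 hyN
  have hex : ∃ j, e j = e i := ⟨i, rfl⟩
  have hNi : N' (e i) = splice ε x ⁻¹' N i := by
    simp only [N', dif_pos hex]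
    rw [e.injective hex.choose_spec]
  refine hz (e i) (splice ε z y) (fun β hβ => ?_) ?_
  · by_cases hb : β < ε
    · rw [splice_of_lt _ _ hb]
    · rw [splice_of_le _ _ (not_lt.1 hb), ← hy, splice_of_le _ _ (not_lt.1 hb)]
      exact lt_trans hβ ((hγ (hξ i)).trans ((le_max_right _ _).trans_lt hδ))
  · rw [hNi, mem_preimage, splice_splice, splice_eq_of_eqOn]
    · exact hi
    · exact (eqOn_splice _ _ _).trans (hy.mono (Iio_subset_Iio ((le_max_left _ _).trans hδ.le)))

theorem exists_monotone_isNwd {A : Set (Space κ)} (hA : A ∈ meagreIdeal κ) :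
    ∃ N : Idx κ → Set (Space κ), (∀ α, IsNwd (N α)) ∧ Monotone N ∧ A = ⋃ α, N α := by
  obtain ⟨N, hN, rfl⟩ := hA
  refine ⟨fun α => ⋃ i : Iic α, N i, fun α => isNwd_iUnion (mk_Iic_idx_lt α) fun i => hN i,
    fun α α' h => ?_, ?_⟩
  · exact iUnion_subset fun i => subset_iUnion (fun i : Iic α' => N i) ⟨i.1, le_trans i.2 h⟩
  · refine subset_antisymm (iUnion_subset fun α => ?_)
      (iUnion_subset fun α => iUnion_subset fun i => subset_iUnion N i)
    exact (subset_iUnion (fun i : Iic α => N i) ⟨α, mem_Iic.2 le_rfl⟩).trans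
      (subset_iUnion (fun α => ⋃ i : Iic α, N i) α)

theorem mem_meagreIdeal_of_subset {A B : Set (Space κ)} (hB : B ∈ meagreIdeal κ) (h : A ⊆ B) :
    A ∈ meagreIdeal κ := by
  obtain ⟨N, hN, rfl⟩ := hB
  refine ⟨fun α => A ∩ N α, fun α => (hN α).mono inter_subset_right, ?_⟩
  rw [← inter_iUnion, inter_eq_left.2 h]

/-- A set is meagre if membership in it means that almost all of `κ` many properties hold, each
of which can be violated, beyond any given initial segment, by extending that segment. -/
theorem setOf_almostAll_mem_meagreIdeal {P : Idx κ → Space κ → Prop}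
    (h : ∀ (β : Idx κ) (x : Space κ) (γ : Idx κ), ∃ α > β, ∃ (x' : Space κ) (δ : Idx κ), γ < δ ∧
      EqOn x x' (Iio γ) ∧ ∀ y, EqOn x' y (Iio δ) → ¬ P α y) :
    {x | AlmostAll fun α => P α x} ∈ meagreIdeal κ := by
  refine ⟨fun β => {x | ∀ α, β < α → P α x}, fun β => isNwd_iff.2 fun x γ => ?_, ?_⟩
  · obtain ⟨α, hα, x', δ, h1, h2, h3⟩ := h β x γ
    exact ⟨x', δ, h1, h2, fun y hy hP => h3 y hy (hP α hα)⟩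
  · ext x
    simp [AlmostAll]

/-- For a nowhere dense set `N` and `α` there is a single function `p` such that every function
which maps `α` to `α` and continues like `p` is outside `N`, as soon as it has followed `p` on a
long enough interval `[α, γ)`. -/
theorem IsNwd.exists_uniform_extension {N : Set (Space κ)} (hN : IsNwd N) (α : Idx κ) :
    ∃ γ > α, ∃ p ∈ boundedFun γ, ∀ x : Space κ, (∀ β < α, x β < α) →
      EqOn p x (Ico α γ) → x ∉ N := by
  -- Extending a function beyond `α` so as to avoid the union of the sets `splice α s ⁻¹' N` works
  -- for all `s` at once.
  have hU : IsNwd (⋃ s : boundedFun α, splice α s.1 ⁻¹' N) :=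
    isNwd_iUnion (mk_boundedFun_lt α) fun s => hN.preimage_splice _ _
  obtain ⟨x', δ, hδ, -, h⟩ := isNwd_iff.1 hU (fun _ => ⊥) α
  obtain ⟨ε, hε⟩ := exists_forall_Iio_lt δ x'
  obtain ⟨γ, hγ⟩ := exists_gt (max δ ε)
  have hδγ : δ < γ := (le_max_left _ _).trans_lt hγ
  have hεγ : ε < γ := (le_max_right _ _).trans_lt hγ
  refine ⟨γ, hδ.trans hδγ, splice δ x' fun _ => ⊥, ⟨fun β hβ => ?_, fun β hβ => ?_⟩, ?_⟩
  · by_cases hb : β < δ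
    · rw [splice_of_lt _ _ hb]
      exact (hε β hb).trans hεγ
    · rw [splice_of_le _ _ (not_lt.1 hb)]
      exact bot_le.trans_lt hβ
  · rw [splice_of_le _ _ (hδγ.le.trans hβ)]
  · intro x hx hpx hxN
    refine h (splice α x' x) (fun β hβ => ?_) (mem_iUnion.2 ⟨⟨splice α x fun _ => ⊥, ?_, ?_⟩, ?_⟩)
    · by_cases hb : β < α
      · rw [splice_of_lt _ _ hb]
      · rw [splice_of_le _ _ (not_lt.1 hb), ← hpx ⟨not_lt.1 hb, lt_trans hβ hδγ⟩,
          splice_of_lt _ _ hβ]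
    · intro β hβ
      rw [splice_of_lt _ _ hβ]
      exact hx β hβ
    · intro β hβ
      rw [splice_of_le _ _ hβ]
    · rw [mem_preimage, splice_splice, splice_eq_of_eqOn]
      · exact hxN
      · exact (eqOn_splice _ _ _).symm

end Meagre

section Tukey

/-! ### Growth rates of meagre sets -/

theorem not_leStar {f g : Space κ} : ¬ LeStar f g ↔ ∀ β, ∃ α, β < α ∧ g α < f α := by
  simp [LeStar, AlmostAll]

theorem not_eqInf {f g : Space κ} : ¬ EqInf f g ↔ AlmostAll fun α => f α ≠ g α := by
  simp [EqInf, CofinallyMany, AlmostAll]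

theorem notMem_iUnion_of_cofinal {N : Idx κ → Set (Space κ)} (hmono : Monotone N) {x : Space κ}
    (h : ∀ β, ∃ α, β ≤ α ∧ x ∉ N α) : x ∉ ⋃ α, N α := by
  intro hx
  obtain ⟨β, hβ⟩ := mem_iUnion.1 hx
  obtain ⟨α, hα, hxα⟩ := h β
  exact hxα (hmono hα hβ)

variable [hκ : Fact κ.IsInaccessible]

/-- `g` is a growth rate for the sequence `N` of nowhere dense sets: for each `α` a single
continuation `p` of length and values below `g α` takes every function from `α` to `α` out of
`N α`. -/
def IsEscapeRate (N : Idx κ → Set (Space κ)) (g : Space κ) : Prop :=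
  ∀ α, α < g α ∧ ∃ p ∈ boundedFun (g α), ∀ x : Space κ, (∀ β < α, x β < α) →
    EqOn p x (Ico α (g α)) → x ∉ N α

theorem exists_isEscapeRate {A : Set (Space κ)} (hA : A ∈ meagreIdeal κ) :
    ∃ (N : Idx κ → Set (Space κ)) (g : Space κ), Monotone N ∧ A = ⋃ α, N α ∧
      IsEscapeRate N g := by
  obtain ⟨N, hN, hmono, rfl⟩ := exists_monotone_isNwd hA
  choose g hg hp using fun α => (hN α).exists_uniform_extension α
  exact ⟨N, g, hmono, rfl, fun α => ⟨hg α, hp α⟩⟩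

/-! ### Domination and meagre sets -/

theorem setOf_leStar_mem_meagreIdeal (f : Space κ) : {x | LeStar x f} ∈ meagreIdeal κ := by
  refine setOf_almostAll_mem_meagreIdeal fun β x γ => ?_
  obtain ⟨α, hα⟩ := exists_gt (max β γ)
  obtain ⟨δ, hδ⟩ := exists_gt α
  obtain ⟨ε, hε⟩ := exists_gt (f α)
  have hγα : γ < α := (le_max_right _ _).trans_lt hα
  refine ⟨α, (le_max_left _ _).trans_lt hα, splice γ x fun _ => ε, δ, hγα.trans hδ,
    eqOn_splice _ _ _, fun y hy => not_le.2 ?_⟩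
  rw [← hy hδ, splice_of_le _ _ hγα.le]
  exact hε

/-- If `f` is monotone and exceeds a growth rate of a meagre set cofinally often, then it bounds
a function outside that set: at each place where `f` exceeds the rate, there is enough room
below `f` to escape from one more nowhere dense set. -/
theorem exists_le_notMem {N : Idx κ → Set (Space κ)} (hmono : Monotone N) {g f : Space κ}
    (hg : IsEscapeRate N g) (hf : Monotone f) (hfg : ¬ LeStar f g) :
    ∃ x : Space κ, (∀ β, x β ≤ f β) ∧ x ∉ ⋃ α, N α := by
  rw [not_leStar] at hfg
  obtain ⟨x, δ, γ, -, -, hcov, hQ⟩ := exists_fusion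
    (fun ξ δ γ x => (∀ β, δ ≤ β → β < γ → x β ≤ f β) ∧ ∃ α, ξ ≤ α ∧ x ∉ N α) (by
      intro ξ δ y
      obtain ⟨ε, hε⟩ := exists_forall_Iio_lt δ y
      obtain ⟨α, hα, hgf⟩ := hfg (max ξ (max δ ε))
      obtain ⟨hξα, hα'⟩ := max_lt_iff.1 hα
      obtain ⟨hδα, hεα⟩ := max_lt_iff.1 hα'
      obtain ⟨hαg, p, hp, hpN⟩ := hg α
      have hlow : ∀ β, δ ≤ β → β < α → splice δ y (splice α (fun _ => ⊥) p) β = ⊥ :=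
        fun β h1 h2 => by rw [splice_of_le _ _ h1, splice_of_lt _ _ h2]
      have hhigh : ∀ β, α ≤ β → splice δ y (splice α (fun _ => ⊥) p) β = p β :=
        fun β h => by rw [splice_of_le _ _ (hδα.le.trans h), splice_of_le _ _ h]
      refine ⟨g α, hδα.trans hαg, splice δ y (splice α (fun _ => ⊥) p), eqOn_splice _ _ _,
        fun z hz => ⟨fun β h1 h2 => ?_, α, hξα.le, hpN z (fun β hβ => ?_) fun β hβ => ?_⟩⟩
      · rw [← hz h2]
        by_cases hb : β < α
        · rw [hlow β h1 hb]
          exact bot_le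
        · rw [hhigh β (not_lt.1 hb)]
          exact ((hp.1 β h2).trans hgf).le.trans (hf (not_lt.1 hb))
      · rw [← hz (lt_trans hβ hαg)]
        by_cases hb : β < δ
        · rw [splice_of_lt _ _ hb]
          exact (hε β hb).trans hεα
        · rw [hlow β (not_lt.1 hb) hβ]
          exact bot_le.trans_lt hβ
      · rw [← hz hβ.2, hhigh β hβ.1])
  refine ⟨x, fun β => ?_, notMem_iUnion_of_cofinal hmono fun ξ => (hQ ξ).2⟩
  obtain ⟨ξ, h1, h2⟩ := hcov β
  exact (hQ ξ).1 β h1 h2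

/-! ### Bounded spaces and meagre sets -/

theorem IsBound.exists_bot_lt {b : Space κ} (hb : IsBound b) (α : Idx κ) :
    ∃ β, ⊥ < β ∧ β < b α := by
  obtain ⟨c, hc, hbc⟩ := hb.2 α
  have h1 : (1 : Ordinal.{u}) < (b α).toOrd := by
    rw [hbc, lt_ord, Ordinal.card_one]
    exact one_lt_aleph0.trans_le hc
  have h2 : (1 : Ordinal.{u}) < κ.ord := h1.trans (b α).toOrd.2
  refine ⟨Ordinal.ToType.mk ⟨1, h2⟩, ?_, ?_⟩
  · refine bot_le.trans_lt (Ordinal.ToType.mk.strictMono (a := ⟨0, one_pos.trans h2⟩) ?_)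
    exact Subtype.mk_lt_mk.2 one_pos
  · rw [← OrderIso.lt_symm_apply]
    exact h1

open Classical in
/-- The retraction of `^κ κ` to `∏ b` that replaces too large values by `0`. -/
noncomputable def truncate (b x : Space κ) : Space κ := fun α => if x α < b α then x α else ⊥

theorem truncate_mem {b : Space κ} (hb : IsBound b) (x : Space κ) : truncate b x ∈ prodBelow b := by
  intro α
  obtain ⟨β, h1, h2⟩ := hb.exists_bot_lt α
  unfold truncate
  split_ifs with h
  · exact h
  · exact h1.trans h2

theorem setOf_not_eqInf_mem_meagreIdeal {b g : Space κ} (hg : g ∈ prodBelow b) :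
    {x | ¬ EqInf (truncate b x) g} ∈ meagreIdeal κ := by
  simp only [not_eqInf]
  refine setOf_almostAll_mem_meagreIdeal fun β x γ => ?_
  obtain ⟨α, hα⟩ := exists_gt (max β γ)
  obtain ⟨δ, hδ⟩ := exists_gt α
  have hγα : γ < α := (le_max_right _ _).trans_lt hα
  refine ⟨α, (le_max_left _ _).trans_lt hα, splice γ x fun _ => g α, δ, hγα.trans hδ,
    eqOn_splice _ _ _, fun y hy => not_not.2 ?_⟩
  have : y α = g α := by rw [← hy hδ, splice_of_le _ _ hγα.le]
  unfold truncate
  rw [this, if_pos (hg α)]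

theorem eqInf_refl (f : Space κ) : EqInf f f := fun β => by
  obtain ⟨α, hα⟩ := exists_gt β
  exact ⟨α, hα, rfl⟩

theorem IsBound.exists_not_eqInf {b : Space κ} (hb : IsBound b) (f : Space κ) :
    ∃ g ∈ prodBelow b, ¬ EqInf f g := by
  classical
  choose c hc hcb using hb.exists_bot_lt
  refine ⟨fun α => if f α = ⊥ then c α else ⊥, fun α => ?_, fun h => ?_⟩
  · dsimp only
    split_ifs
    · exact hcb α
    · exact (hc α).trans (hcb α)
  · obtain ⟨α, -, hα⟩ := h ⊥
    change f α = if f α = ⊥ then c α else ⊥ at hα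
    by_cases h0 : f α = ⊥
    · rw [if_pos h0, h0] at hα
      exact (hc α).ne hα
    · rw [if_neg h0] at hα
      exact h0 hα

/-! ### Covering meagre sets -/

/-- The sequence `δ` leaves room for `h`: the intervals `[δ ξ, h (δ ξ))` are disjoint. -/
theorem exists_sparse_sequence (h : Space κ) : ∃ δ : Idx κ → Idx κ, ∀ ξ, ∀ η < ξ, h (δ η) ≤ δ ξ :=
  exists_forall_rec (fun ξ F d => ∀ η < ξ, h (F η) ≤ d)
    (fun ξ F F' d hF hd η hη => by rw [← hF η hη]; exact hd η hη)
    (fun ξ F => by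
      obtain ⟨β, hβ⟩ := exists_forall_Iio_lt ξ fun η => h (F η)
      exact ⟨β, fun η hη => (hβ η hη).le⟩)

/-- The combinatorial core. Fix `h`. Meagre sets whose growth rate is dominated by `h` are coded
by elements `u` of one product `∏ b`. If `f =^∞ u`, then the set is covered by any meagre set
`M f h'` such that `h'` dominates a function `k` measuring the gaps between the places where `f`
and `u` agree. -/
theorem exists_meagre_cover (h : Space κ) : ∃ b : Space κ, IsBound b ∧
    ∃ M : Space κ → Space κ → Set (Space κ), (∀ f h', M f h' ∈ meagreIdeal κ) ∧
      ∀ (N : Idx κ → Set (Space κ)) (g : Space κ), Monotone N → IsEscapeRate N g → LeStar g h →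
        ∃ u ∈ prodBelow b, ∀ f, EqInf f u → ∃ k, ∀ h', LeStar k h' → ⋃ α, N α ⊆ M f h' := by
  classical
  -- Enlarge `h` so that `[α, H α)` is never empty.
  obtain ⟨H, hhH, hH⟩ : ∃ H : Space κ, (∀ α, h α ≤ H α) ∧ ∀ α, α < H α := by
    choose H hH using fun α => exists_gt (max (h α) α)
    exact ⟨H, fun α => (le_max_left _ _).trans (hH α).le,
      fun α => (le_max_right _ _).trans_lt (hH α)⟩
  obtain ⟨δ, hδ⟩ := exists_sparse_sequence H
  let γ : Idx κ → Idx κ := fun ξ => H (δ ξ)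
  have hδγ : ∀ ξ, δ ξ < γ ξ := fun ξ => hH _
  have hδmono : StrictMono δ := fun η ξ hη => (hδγ η).trans_le (hδ ξ η hη)
  have hγmono : StrictMono γ := fun η ξ hη => (hδ ξ η hη).trans_lt (hδγ ξ)
  obtain ⟨b, hb, e, he, hesurj⟩ := exists_isBound_coding γ hγmono.monotone
  refine ⟨b, hb, ?_⟩
  -- Each `f` codes the function `z f` that on `[δ ξ, γ ξ)` follows the function with code `f ξ`.
  have hz : ∀ f : Space κ, ∃ z : Space κ,
      (∀ ξ β, δ ξ ≤ β → β < γ ξ → z β = e ξ (f ξ) β) ∧ ∀ ξ, ∀ β < δ ξ, z β < δ ξ := by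
    intro f
    have huniq : ∀ ξ η β, δ ξ ≤ β → β < γ ξ → δ η ≤ β → β < γ η → ξ = η := by
      intro ξ η β h1 h2 h3 h4
      rcases lt_trichotomy ξ η with hlt | hlt | hlt
      · exact absurd ((hδ η ξ hlt).trans h3) h2.not_ge
      · exact hlt
      · exact absurd ((hδ ξ η hlt).trans h1) h4.not_ge
    refine ⟨fun β => if hb : ∃ ξ, δ ξ ≤ β ∧ β < γ ξ then e hb.choose (f hb.choose) β else ⊥,
      fun ξ β h1 h2 => ?_, fun ξ β hβ => ?_⟩
    · have hex : ∃ ξ, δ ξ ≤ β ∧ β < γ ξ := ⟨ξ, h1, h2⟩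
      simp only [dif_pos hex]
      rw [huniq _ ξ β hex.choose_spec.1 hex.choose_spec.2 h1 h2]
    · dsimp only
      split_ifs with hex
      · have h1 := hex.choose_spec
        refine ((he _ _).1 β h1.2).trans_le (hδ ξ _ ?_)
        exact hδmono.lt_iff_lt.1 (h1.1.trans_lt hβ)
      · exact bot_le.trans_lt hβ
  choose z hz1 hz2 using hz
  refine ⟨fun f h' => {x | AlmostAll fun ξ =>
      ¬ ((∀ β < δ ξ, x β < δ ξ) ∧ EqOn (z f) x (Ico (δ ξ) (γ (h' ξ))))}, fun f h' => ?_, ?_⟩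
  · refine setOf_almostAll_mem_meagreIdeal fun β x ε => ?_
    obtain ⟨ρ, hρ⟩ := exists_forall_Iio_lt ε x
    obtain ⟨α, hα⟩ := exists_gt (max β (max ε ρ))
    obtain ⟨hβα, hα'⟩ := max_lt_iff.1 hα
    obtain ⟨hεα, hρα⟩ := max_lt_iff.1 hα'
    have hαδ : α ≤ δ α := hδmono.le_apply
    obtain ⟨σ, hσ⟩ := exists_gt (max (δ α) (γ (h' α)))
    obtain ⟨hδσ, hγσ⟩ := max_lt_iff.1 hσ
    refine ⟨α, hβα, splice ε x (splice (δ α) (fun _ => ⊥) (z f)), σ,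
      (hεα.trans_le hαδ).trans hδσ, eqOn_splice _ _ _,
      fun y hy => not_not.2 ⟨fun β' hβ' => ?_, fun β' hβ' => ?_⟩⟩
    · rw [← hy (lt_trans hβ' hδσ)]
      by_cases hb : β' < ε
      · rw [splice_of_lt _ _ hb]
        exact ((hρ β' hb).trans hρα).trans_le hαδ
      · rw [splice_of_le _ _ (not_lt.1 hb), splice_of_lt _ _ hβ']
        exact bot_le.trans_lt hβ'
    · rw [← hy (lt_trans hβ'.2 hγσ), splice_of_le _ _ ((hεα.trans_le hαδ).le.trans hβ'.1),
        splice_of_le _ _ hβ'.1]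
  · intro N g hmono hg hgh
    obtain ⟨β₀, hβ₀⟩ := hgh
    -- Beyond `β₀` the escaping continuations for `N (δ ξ)` fit below `γ ξ`; `u` codes them.
    have hu : ∀ ξ, ∃ v < b ξ, β₀ < ξ → ∀ x : Space κ, (∀ β < δ ξ, x β < δ ξ) →
        EqOn (e ξ v) x (Ico (δ ξ) (γ ξ)) → x ∉ N (δ ξ) := by
      intro ξ
      by_cases hξ : β₀ < ξ
      · obtain ⟨-, p, hp, hpN⟩ := hg (δ ξ)
        have hle : g (δ ξ) ≤ γ ξ := (hβ₀ _ (hξ.trans_le hδmono.le_apply)).trans (hhH _)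
        obtain ⟨v, hv, hev⟩ := hesurj ξ p (boundedFun_mono hle hp)
        refine ⟨v, hv, fun _ x hx hpx => hpN x hx fun β hβ => ?_⟩
        rw [← hpx ⟨hβ.1, hβ.2.trans_le hle⟩, hev]
      · obtain ⟨v, -, hv⟩ := hb.exists_bot_lt ξ
        exact ⟨v, hv, fun h => absurd h hξ⟩
    choose u hub hu using hu
    refine ⟨u, hub, fun f hf => ?_⟩
    choose k hk hfk using hf
    refine ⟨k, fun h' ⟨β₁, hβ₁⟩ x hx => ?_⟩
    by_contra hxM
    refine notMem_iUnion_of_cofinal hmono (fun β => ?_) hx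
    simp only [mem_ofPred_eq, AlmostAll, not_exists, not_forall, not_not] at hxM
    obtain ⟨ξ, hξ, hx1, hx2⟩ := hxM (max β (max β₀ β₁))
    obtain ⟨hβξ, hξ'⟩ := max_lt_iff.1 hξ
    obtain ⟨hβ₀ξ, hβ₁ξ⟩ := max_lt_iff.1 hξ'
    -- `f` and `u` agree at the place `k ξ`, which lies in the block of `ξ`.
    have hδk : δ ξ ≤ δ (k ξ) := (hδmono (hk ξ)).le
    have hγk : γ (k ξ) ≤ γ (h' ξ) := hγmono.monotone (hβ₁ ξ hβ₁ξ)
    refine ⟨δ (k ξ), hβξ.le.trans (((hk ξ).le).trans hδmono.le_apply),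
      hu (k ξ) (hβ₀ξ.trans (hk ξ)) x (fun β' hβ' => ?_) fun β' hβ' => ?_⟩
    · by_cases hb : β' < δ ξ
      · exact (hx1 β' hb).trans_le hδk
      · rw [← hx2 ⟨not_lt.1 hb, (hβ'.trans (hδγ _)).trans_le hγk⟩]
        exact hz2 f _ _ hβ'
    · rw [← hx2 ⟨hδk.trans hβ'.1, hβ'.2.trans_le hγk⟩, hz1 f _ _ hβ'.1 hβ'.2, hfk]

end Tukey

section Norms

/-! ### Norms -/

theorem RelSystem.exists_mk_eq_norm (S : RelSystem.{u}) (h : ∀ x, ∃ y, S.R x y) :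
    ∃ W : Set S.Y, #W = S.norm ∧ ∀ x, ∃ y ∈ W, S.R x y :=
  csInf_mem (s := {c | ∃ W : Set S.Y, #W = c ∧ ∀ x : S.X, ∃ y ∈ W, S.R x y})
    ⟨_, univ, rfl, fun x => (h x).imp fun y hy => ⟨mem_univ y, hy⟩⟩

theorem RelSystem.norm_le (S : RelSystem.{u}) {ι : Type u} (f : ι → S.Y)
    (h : ∀ x, ∃ i, S.R x (f i)) : S.norm ≤ #ι := by
  have h1 : S.norm ≤ #(range f) := csInf_le' ⟨range f, rfl, fun x => by
    obtain ⟨i, hi⟩ := h x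
    exact ⟨f i, mem_range_self i, hi⟩⟩
  exact h1.trans mk_range_le

theorem RelSystem.exists_forall_not_of_lt_norm (S : RelSystem.{u}) {ι : Type u}
    (hι : #ι < S.norm) (f : ι → S.Y) : ∃ x, ∀ i, ¬ S.R x (f i) := by
  by_contra! h
  exact (S.norm_le f h).not_gt hι

theorem addIdeal_le {Z ι : Type u} {I : Set (Set Z)} (A : ι → Set Z) (hA : ∀ i, A i ∈ I)
    (h : ⋃ i, A i ∉ I) : addIdeal I ≤ #ι := by
  have h1 : addIdeal I ≤ #(range A) :=
    csInf_le' ⟨range A, range_subset_iff.2 hA, by rwa [sUnion_range], rfl⟩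
  exact h1.trans mk_range_le

theorem exists_mk_eq_cofIdeal {Z : Type u} (I : Set (Set Z)) :
    ∃ F : Set (Set Z), F ⊆ I ∧ (∀ A ∈ I, ∃ B ∈ F, A ⊆ B) ∧ #F = cofIdeal I :=
  csInf_mem (s := {c | ∃ F : Set (Set Z), F ⊆ I ∧ (∀ A ∈ I, ∃ B ∈ F, A ⊆ B) ∧ #F = c})
    ⟨_, I, Subset.rfl, fun A hA => ⟨A, hA, Subset.rfl⟩, rfl⟩

theorem cofIdeal_le {Z ι : Type u} {I : Set (Set Z)} (B : ι → Set Z) (hB : ∀ i, B i ∈ I)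
    (h : ∀ A ∈ I, ∃ i, A ⊆ B i) : cofIdeal I ≤ #ι := by
  have h1 : cofIdeal I ≤ #(range B) :=
    csInf_le' ⟨range B, range_subset_iff.2 hB, fun A hA => by
      obtain ⟨i, hi⟩ := h A hA
      exact ⟨B i, mem_range_self i, hi⟩, rfl⟩
  exact h1.trans mk_range_le

theorem cofEqNumber_le_supCofEq {b : Space κ} (hb : IsBound b) : cofEqNumber b ≤ supCofEq κ := by
  refine le_csSup ?_ ⟨b, hb, rfl⟩
  refine (bddAbove_of_small (s := range (cofEqNumber (κ := κ)))).mono ?_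
  rintro _ ⟨b, -, rfl⟩
  exact mem_range_self b

theorem infEvtDiff_le_evtDiffNumber {b : Space κ} (hb : IsBound b) :
    infEvtDiff κ ≤ evtDiffNumber b :=
  csInf_le' ⟨b, hb, rfl⟩

variable [hκ : Fact κ.IsInaccessible]

theorem infEvtDiff_eq_evtDiffNumber : ∃ b : Space κ, IsBound b ∧ infEvtDiff κ = evtDiffNumber b :=
  csInf_mem (s := {c | ∃ b : Space κ, IsBound b ∧ c = evtDiffNumber b}) <| by
    obtain ⟨b, hb, -⟩ := exists_isBound_coding (fun _ : Idx κ => ⊥) monotone_const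
    exact ⟨_, b, hb, rfl⟩

theorem exists_not_leStar (g : Space κ) : ∃ f, ¬ LeStar f g := by
  choose f hf using fun α => exists_gt (g α)
  refine ⟨f, not_leStar.2 fun β => ?_⟩
  obtain ⟨α, hα⟩ := exists_gt β
  exact ⟨α, hα, hf α⟩

theorem exists_mk_eq_domNumber :
    ∃ D : Set (Space κ), #D = domNumber κ ∧ ∀ f, ∃ g ∈ D, LeStar f g := by
  obtain ⟨W, hW, h⟩ := (domSystem (univ : Set (Space κ))).exists_mk_eq_norm
    fun f => ⟨f, ⊥, fun α _ => le_rfl⟩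
  refine ⟨Subtype.val '' W, (mk_image_eq Subtype.val_injective).trans hW, fun f => ?_⟩
  obtain ⟨g, hg, hfg⟩ := h ⟨f, mem_univ f⟩
  exact ⟨g.1, mem_image_of_mem _ hg, hfg⟩

/-- A dominating family is infinite, because finitely many functions are strictly bounded at
each place. -/
theorem aleph0_le_domNumber : ℵ₀ ≤ domNumber κ := by
  obtain ⟨D, hD, hdom⟩ := exists_mk_eq_domNumber (κ := κ)
  by_contra! hlt
  rw [← hD] at hlt
  choose g hg using fun α => exists_forall_lt (hlt.trans hκ.out.aleph0_lt) fun f : D => f.1 α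
  obtain ⟨f, hf, β, hβ⟩ := hdom g
  obtain ⟨α, hα⟩ := exists_gt β
  exact (hβ α hα).not_gt (hg α ⟨f, hf⟩)

/-! ### The inequalities -/

theorem addIdeal_le_unbNumber : addIdeal (meagreIdeal κ) ≤ unbNumber κ := by
  obtain ⟨W, hW, h⟩ := (domSystem (univ : Set (Space κ))).dual.exists_mk_eq_norm fun g => by
    obtain ⟨f, hf⟩ := exists_not_leStar g.1
    exact ⟨⟨f, mem_univ f⟩, hf⟩
  rw [unbNumber, ← hW]
  choose F hF hle using fun f : Space κ => exists_monotone_ge f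
  refine addIdeal_le (fun f : W => {x | LeStar x (F f.1.1)})
    (fun f => setOf_leStar_mem_meagreIdeal _) fun hU => ?_
  obtain ⟨N, g, hmono, hN, hg⟩ := exists_isEscapeRate hU
  obtain ⟨f, hf, hfg⟩ := h ⟨g, mem_univ g⟩
  have hFg : ¬ LeStar (F f.1) g := fun ⟨β, hβ⟩ =>
    hfg ⟨β, fun α hα => (hle f.1 α).trans (hβ α hα)⟩
  obtain ⟨x, hx, hxN⟩ := exists_le_notMem hmono hg (hF _) hFg
  rw [← hN] at hxN
  exact hxN (mem_iUnion.2 ⟨⟨f, hf⟩, ⊥, fun α _ => hx α⟩)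

theorem domNumber_le_cofIdeal : domNumber κ ≤ cofIdeal (meagreIdeal κ) := by
  obtain ⟨F, hFI, hF, hcard⟩ := exists_mk_eq_cofIdeal (meagreIdeal κ)
  rw [← hcard]
  choose N g hmono hN hg using fun B : F => exists_isEscapeRate (hFI B.2)
  refine (domSystem univ).norm_le (fun B => ⟨g B, mem_univ _⟩) fun f => ?_
  obtain ⟨f', hf', hle⟩ := exists_monotone_ge f.1
  obtain ⟨B, hB, hsub⟩ := hF _ (setOf_leStar_mem_meagreIdeal f')
  refine ⟨⟨B, hB⟩, ?_⟩
  by_contra hfg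
  have hf'g : ¬ LeStar f' (g ⟨B, hB⟩) := fun ⟨β, hβ⟩ =>
    hfg ⟨β, fun α hα => (hle α).trans (hβ α hα)⟩
  obtain ⟨x, hx, hxN⟩ := exists_le_notMem (hmono _) (hg _) hf' hf'g
  rw [← hN] at hxN
  exact hxN (hsub ⟨⊥, fun α _ => hx α⟩)

theorem addIdeal_le_evtDiffNumber {b : Space κ} (hb : IsBound b) :
    addIdeal (meagreIdeal κ) ≤ evtDiffNumber b := by
  obtain ⟨W, hW, h⟩ := (evtDiffSystem (prodBelow b)).exists_mk_eq_norm fun f => by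
    obtain ⟨g, hg, hfg⟩ := hb.exists_not_eqInf f.1
    exact ⟨⟨g, hg⟩, hfg⟩
  rw [evtDiffNumber, ← hW]
  refine addIdeal_le (fun g : W => {x | ¬ EqInf (truncate b x) g.1.1})
    (fun g => setOf_not_eqInf_mem_meagreIdeal g.1.2) ?_
  convert univ_notMem_meagreIdeal (κ := κ)
  refine eq_univ_of_forall fun x => ?_
  obtain ⟨g, hg, hxg⟩ := h ⟨truncate b x, truncate_mem hb x⟩
  exact mem_iUnion.2 ⟨⟨g, hg⟩, hxg⟩

theorem cofEqNumber_le_cofIdeal {b : Space κ} (hb : IsBound b) :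
    cofEqNumber b ≤ cofIdeal (meagreIdeal κ) := by
  obtain ⟨F, hFI, hF, hcard⟩ := exists_mk_eq_cofIdeal (meagreIdeal κ)
  rw [← hcard]
  -- By the Baire category theorem each member of `F` misses some point.
  have hx : ∀ B : F, ∃ x, x ∉ B.1 := fun B => by
    by_contra! hall
    exact univ_notMem_meagreIdeal (eq_univ_of_forall hall ▸ hFI B.2)
  choose x hx using hx
  refine (evtDiffSystem (prodBelow b)).dual.norm_le
    (fun B => ⟨truncate b (x B), truncate_mem hb _⟩) fun g => ?_
  obtain ⟨B, hB, hsub⟩ := hF _ (setOf_not_eqInf_mem_meagreIdeal g.2)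
  exact ⟨⟨B, hB⟩, fun hne => hx ⟨B, hB⟩ (hsub hne)⟩

theorem min_le_addIdeal :
    min (unbNumber κ) (infEvtDiff κ) ≤ addIdeal (meagreIdeal κ) := by
  refine le_csInf ⟨_, meagreIdeal κ, Subset.rfl, fun h => ?_, rfl⟩ ?_
  · refine univ_notMem_meagreIdeal (mem_meagreIdeal_of_subset h fun x _ => ?_)
    exact mem_sUnion.2 ⟨_, setOf_leStar_mem_meagreIdeal x, ⊥, fun α _ => le_rfl⟩
  · rintro _ ⟨F, hFI, hF, rfl⟩
    by_contra! hlt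
    obtain ⟨hlt_unb, hlt_inf⟩ := lt_min_iff.1 hlt
    choose N g hmono hN hg using fun A : F => exists_isEscapeRate (hFI A.2)
    obtain ⟨h, hh⟩ := (domSystem univ).dual.exists_forall_not_of_lt_norm hlt_unb
      fun A => ⟨g A, mem_univ _⟩
    obtain ⟨b, hb, M, hM, hcov⟩ := exists_meagre_cover h.1
    choose u hub hu using fun A : F => hcov (N A) (g A) (hmono A) (hg A) (not_not.1 (hh A))
    obtain ⟨f, hf⟩ := (evtDiffSystem (prodBelow b)).exists_forall_not_of_lt_norm
      (hlt_inf.trans_le (infEvtDiff_le_evtDiffNumber hb)) fun A => ⟨u A, hub A⟩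
    choose k hk using fun A : F => hu A f.1 (not_not.1 (hf A))
    obtain ⟨h', hh'⟩ := (domSystem univ).dual.exists_forall_not_of_lt_norm hlt_unb
      fun A => ⟨k A, mem_univ _⟩
    refine hF (mem_meagreIdeal_of_subset (hM f.1 h'.1) (sUnion_subset fun A hA => ?_))
    have := hk ⟨A, hA⟩ h'.1 (not_not.1 (hh' ⟨A, hA⟩))
    rwa [← hN] at this

theorem cofIdeal_le_max :
    cofIdeal (meagreIdeal κ) ≤ max (domNumber κ) (supCofEq κ) := by
  obtain ⟨D, hD, hdom⟩ := exists_mk_eq_domNumber (κ := κ)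
  choose b hb M hM hcov using fun h : D => exists_meagre_cover h.1
  have hW : ∀ h : D, ∃ W : Set (prodBelow (b h)), #W = cofEqNumber (b h) ∧
      ∀ u : prodBelow (b h), ∃ f ∈ W, ¬ ¬ EqInf f.1 u.1 := fun h =>
    (evtDiffSystem (prodBelow (b h))).dual.exists_mk_eq_norm
      fun u => ⟨u, not_not.2 (eqInf_refl u.1)⟩
  choose W hWcard hW using hW
  have hle : cofIdeal (meagreIdeal κ) ≤ #(Σ h : D, W h × D) := by
    refine cofIdeal_le (fun t => M t.1 t.2.1.1.1 t.2.2.1) (fun t => hM _ _ _) fun A hA => ?_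
    obtain ⟨N, g, hmono, rfl, hg⟩ := exists_isEscapeRate hA
    obtain ⟨h, hhD, hh⟩ := hdom g
    obtain ⟨u, hub, hu⟩ := hcov ⟨h, hhD⟩ N g hmono hg hh
    obtain ⟨f, hfW, hf⟩ := hW ⟨h, hhD⟩ ⟨u, hub⟩
    obtain ⟨k, hk⟩ := hu f.1 (not_not.1 hf)
    obtain ⟨h', hh'D, hh'⟩ := hdom k
    exact ⟨⟨⟨h, hhD⟩, ⟨f, hfW⟩, ⟨h', hh'D⟩⟩, hk h' hh'⟩
  refine hle.trans ?_
  set m := max (domNumber κ) (supCofEq κ) with hm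
  have hm0 : ℵ₀ ≤ m := aleph0_le_domNumber.trans (le_max_left _ _)
  have hDm : #D ≤ m := hD.trans_le (le_max_left _ _)
  calc #(Σ h : D, W h × D) = Cardinal.sum fun h : D => #(W h × D) := mk_sigma _
    _ ≤ Cardinal.sum fun _ : D => m := by
      refine sum_le_sum _ _ fun h => ?_
      rw [mk_prod, lift_id, lift_id, hWcard]
      exact (mul_le_mul' ((cofEqNumber_le_supCofEq (hb h)).trans (le_max_right _ _)) hDm).trans
        (mul_eq_self hm0).le
    _ = #D * m := by rw [sum_const']
    _ ≤ m := (mul_le_mul' hDm le_rfl).trans (mul_eq_self hm0).le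

end Norms

end GenBaire

theorem mainTheorem11 (κ : Cardinal.{u}) (hκ : κ.IsInaccessible) :
    GenBaire.addIdeal (GenBaire.meagreIdeal κ) =
        min (GenBaire.unbNumber κ) (GenBaire.infEvtDiff κ) ∧
      GenBaire.cofIdeal (GenBaire.meagreIdeal κ) =
        max (GenBaire.domNumber κ) (GenBaire.supCofEq κ) := by
  have : Fact κ.IsInaccessible := ⟨hκ⟩
  constructor
  · refine le_antisymm (le_min GenBaire.addIdeal_le_unbNumber ?_) GenBaire.min_le_addIdeal
    obtain ⟨b, hb, h⟩ := GenBaire.infEvtDiff_eq_evtDiffNumber (κ := κ)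
    exact h ▸ GenBaire.addIdeal_le_evtDiffNumber hb
  · refine le_antisymm GenBaire.cofIdeal_le_max (max_le GenBaire.domNumber_le_cofIdeal ?_)
    refine csSup_le' ?_
    rintro _ ⟨b, hb, rfl⟩
    exact GenBaire.cofEqNumber_le_cofIdeal hb
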